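/- Let $\Gamma$ be a finite non-abelian group, and let $\widehat\Gamma$ be its dual finite quantum group: $C(\widehat\Gamma)=\mathcal O(\widehat\Gamma)=\mathbb C[\Gamma]$ with $\lambda_g^*=\lambda_{g^{-1}}$, $\Delta(\lambda_g)=\lambda_g\otimes\lambda_g$, and the Haar functional $\psi$ normalised by $\psi(\lambda_1)=|\Gamma|$, $\psi(\lambda_g)=0$ for $g\ne 1$. (Then $mm^*=\mathrm{id}$, where $m$ is the multiplication and $m^*$ its adjoint for the inner product $\langle x,y\rangle=\psi(x^*y)$.) For $P\in\mathbb C[\Gamma]$ let $A_P=P\star\cdot=(\psi(S(P)\,\cdot\,)\otimes\mathrm{id})\circ\Delta$ be the operator of convolution by $P$, with $S$ the antipode. Then there is an orthogonal projection $P=\sum_{g}T(g)\lambda_g\in\mathbb C[\Gamma]$ such that $(\widehat\Gamma,A_P)$ is a (directed) quantum graph, i.e. $m(A_P\otimes A_P)m^*=A_P$ and $A_P(f^*)^*=A_P(f)$ for all $f$ (this is the quantum Cayley graph of $P$), and its quantum automorphism group $\mathrm{Qut}(\widehat\Gamma,A_P)$ is equal to $\widehat\Gamma$, acting on itself by the comultiplication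 $\Delta$. This means: $\Delta$ is a faithful action of $\widehat\Gamma$ on $(\widehat\Gamma,A_P)$, and for every action $\beta\colon\mathbb C[\Gamma]\to\mathbb C[\Gamma]\otimes\mathcal O(\mathbb H)$ of a compact quantum group $\mathbb H$ on $(\widehat\Gamma,A_P)$ there is a unique Hopf $^*$-algebra morphism $\gamma\colon\mathbb C[\Gamma]\to\mathcal O(\mathbb H)$ with $(\mathrm{id}\otimes\gamma)\circ\Delta=\beta$. Here a compact quantum group is given by a CQG Hopf $^*$-algebra $\mathcal O(\mathbb H)$, and an action on $(\widehat\Gamma,A_P)$ is an injective unital $^*$-homomorphism $\beta$ with $(\beta\otimes\mathrm{id})\beta=(\mathrm{id}\otimes\Delta_{\mathbb H})\beta$, $(\psi\otimes\mathrm{id})\beta=\psi(\cdot)1$ and $(A_P\otimes\mathrm{id})\beta=\beta A_P$. Moreover, $P$ can be chosen to have rank one in each block of $\mathbb C[\Gamma]$ of dimension greater than one and to vanish in the one-dimensional blocks (that is, $P$ acts as a rank-one operator in every irreducible complex representation of $\Gamma$ of dimension greater than one, and as $0$ in the one-dimensional ones), and so that its Fourier transform $T$ satisfies $T(g)\neq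 T(h)$ for all $g\neq h$ in $\Gamma$ at least one of which is not central. -/

import Mathlib

open scoped TensorProduct ComplexOrder

universe u v w

noncomputable section

/-! ## Finite quantum sets and quantum graphs -/

section QuantumSets

/-- A finite quantum set: a finite-dimensional unital `*`-algebra `B = C(𝕏)` with a positive,
faithful, tracial functional `ψ` for which the multiplication `m` satisfies `m m* = id`, the adjoint
being taken for the inner product `⟨x, y⟩ = ψ (x* y)`.  A finite-dimensional `*`-algebra with a
faithful positive functional is a C*-algebra in a unique way, and every finite-dimensional
C*-algebra carries exactly one such `ψ` (the tracial `1`-form).  The map `m*` is determined by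
`inner_mulAdj`, since `ψ` is faithful. -/
class FiniteQuantumSet (B : Type u) [Ring B] [StarRing B] [Algebra ℂ B] [StarModule ℂ B] where
  finite : Module.Finite ℂ B
  /-- the functional `ψ` -/
  psi : B →ₗ[ℂ] ℂ
  psi_nonneg : ∀ x : B, 0 ≤ psi (star x * x)
  psi_faithful : ∀ x : B, psi (star x * x) = 0 → x = 0
  psi_tracial : ∀ x y : B, psi (x * y) = psi (y * x)
  /-- the adjoint `m* : B → B ⊗ B` of the multiplication -/
  mulAdj : B →ₗ[ℂ] B ⊗[ℂ] B
  /-- `⟨m* x, y ⊗ z⟩ = ⟨x, y z⟩` -/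
  inner_mulAdj : ∀ x y z : B,
    LinearMap.mul' ℂ ℂ (TensorProduct.map psi psi (star (mulAdj x) * (y ⊗ₜ[ℂ] z)))
      = psi (star x * (y * z))
  /-- `m m* = id` -/
  mul_mulAdj : ∀ x : B, LinearMap.mul' ℂ B (mulAdj x) = x

variable {B : Type u} [Ring B] [StarRing B] [Algebra ℂ B] [StarModule ℂ B] [FiniteQuantumSet B]

/-- The Schur product `A₁ • A₂ = m (A₁ ⊗ A₂) m*`. -/
def schurProduct (A₁ A₂ : B →ₗ[ℂ] B) : B →ₗ[ℂ] B :=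
  LinearMap.mul' ℂ B ∘ₗ TensorProduct.map A₁ A₂ ∘ₗ FiniteQuantumSet.mulAdj

/-- `(𝕏, A)` is a (directed) quantum graph: the quantum adjacency matrix `A` is a real Schur
idempotent, `A • A = A = Ā`, where `Ā f = (A f*)*`. -/
structure IsQuantumGraph (A : B →ₗ[ℂ] B) : Prop where
  schur_idempotent : schurProduct A A = A
  real : ∀ f : B, star (A (star f)) = A f

end QuantumSets

/-! ## Compact quantum groups and their actions -/

/-- A square matrix over a Hopf `*`-algebra is a unitary (finite-dimensional) representation of the
quantum group: `Δ u_{ij} = ∑_k u_{ik} ⊗ u_{kj}` and `U` is unitary. -/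
structure IsUnitaryRep {H : Type v} [Ring H] [StarRing H] [HopfAlgebra ℂ H] {n : ℕ}
    (U : Matrix (Fin n) (Fin n) H) : Prop where
  comul_apply : ∀ i j, Coalgebra.comul (R := ℂ) (U i j) = ∑ k, U i k ⊗ₜ[ℂ] U k j
  mul_star_self : U * star U = 1
  star_mul_self : star U * U = 1

/-- A CQG Hopf `*`-algebra `𝒪(ℍ)` (an algebraic compact quantum group): a Hopf algebra over `ℂ` with
an involution for which the comultiplication is a `*`-homomorphism, linearly spanned by the matrix
entries of its finite-dimensional unitary representations. -/
class CQGAlgebra (H : Type v) [Ring H] [StarRing H] [HopfAlgebra ℂ H] [StarModule ℂ H] : Prop where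
  comul_star : ∀ x : H, Coalgebra.comul (R := ℂ) (star x) = star (Coalgebra.comul (R := ℂ) x)
  span_coefficients :
    Submodule.span ℂ {x : H | ∃ (n : ℕ) (U : Matrix (Fin n) (Fin n) H),
      IsUnitaryRep U ∧ ∃ i j, U i j = x} = ⊤

/-- An action of a compact quantum group `ℍ` on the finite quantum space with algebra `B`: an
injective unital `*`-homomorphism `α : B → B ⊗ 𝒪(ℍ)` with `(α ⊗ id) α = (id ⊗ Δ) α`. -/
structure QuantumAction (B : Type u) [Ring B] [StarRing B] [Algebra ℂ B] [StarModule ℂ B]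
    (H : Type v) [Ring H] [StarRing H] [HopfAlgebra ℂ H] [StarModule ℂ H] where
  /-- the map `α` -/
  hom : B →⋆ₐ[ℂ] B ⊗[ℂ] H
  injective : Function.Injective hom
  action_eq : ∀ x : B,
    TensorProduct.assoc ℂ B H H
        (TensorProduct.map hom.toAlgHom.toLinearMap (LinearMap.id : H →ₗ[ℂ] H) (hom x))
      = TensorProduct.map (LinearMap.id : B →ₗ[ℂ] B) (Coalgebra.comul (R := ℂ) (A := H)) (hom x)

section Actions

variable {B : Type u} [Ring B] [StarRing B] [Algebra ℂ B] [StarModule ℂ B]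
variable {H : Type v} [Ring H] [StarRing H] [HopfAlgebra ℂ H] [StarModule ℂ H]

/-- The slice `(ω ⊗ id) (α a)` of an action. -/
def QuantumAction.slice (α : QuantumAction B H) (ω : B →ₗ[ℂ] ℂ) (a : B) : H :=
  TensorProduct.lid ℂ H (TensorProduct.map ω (LinearMap.id : H →ₗ[ℂ] H) (α.hom a))

/-- The action is faithful: the slices generate `𝒪(ℍ)`.  (For an action of a CQG Hopf `*`-algebra
the `*`-subalgebra generated by the slices is automatically a Hopf `*`-subalgebra.) -/
def QuantumAction.IsFaithful (α : QuantumAction B H) : Prop :=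
  StarAlgebra.adjoin ℂ {h : H | ∃ (ω : B →ₗ[ℂ] ℂ) (a : B), α.slice ω a = h} = ⊤

/-- The action `α` is an action on the quantum graph `(𝕏, A)`: it preserves the functional `ψ`,
`(ψ ⊗ id) α = ψ(·) 1`, and the quantum adjacency matrix, `(A ⊗ id) α = α A`. -/
structure QuantumAction.IsGraphAction [FiniteQuantumSet B] (A : B →ₗ[ℂ] B)
    (α : QuantumAction B H) : Prop where
  preserves_psi : ∀ x : B,
    α.slice FiniteQuantumSet.psi x = algebraMap ℂ H (FiniteQuantumSet.psi x)
  preserves_adjacency : ∀ x : B,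
    TensorProduct.map A (LinearMap.id : H →ₗ[ℂ] H) (α.hom x) = α.hom (A x)

/-- The compact quantum group `ℍ`, acting through `α`, is the quantum automorphism group
`Qut(𝕏, A)` of the quantum graph `(𝕏, A)`: it acts faithfully on `(𝕏, A)`, and for every action `β`
of a compact quantum group `𝕂` on `(𝕏, A)` there is exactly one Hopf `*`-algebra morphism
`γ : 𝒪(ℍ) → 𝒪(𝕂)` with `(id ⊗ γ) α = β`. -/
structure IsQuantumAutomorphismGroup [FiniteQuantumSet B] (A : B →ₗ[ℂ] B) [CQGAlgebra H]
    (α : QuantumAction B H) : Prop where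
  isGraphAction : α.IsGraphAction A
  isFaithful : α.IsFaithful
  universal : ∀ (K : Type w) [Ring K] [StarRing K] [HopfAlgebra ℂ K] [StarModule ℂ K]
    [CQGAlgebra K] (β : QuantumAction B K), β.IsGraphAction A →
      ∃! γ : H →ₐc[ℂ] K, (∀ x : H, γ (star x) = star (γ x)) ∧
        ∀ x : B, TensorProduct.map (LinearMap.id : B →ₗ[ℂ] B)
          (γ : H →ₐ[ℂ] K).toLinearMap (α.hom x) = β.hom x

end Actions

/-! ## Finite quantum groups and quantum Cayley graphs

A finite quantum group `𝔾` is given by a CQG Hopf `*`-algebra `G = C(𝔾) = 𝒪(𝔾)` that is a finite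
quantum set; `ψ` is then its Haar functional, normalised to be the tracial `1`-form. -/

section FiniteQuantumGroups

variable (G : Type u) [Ring G] [StarRing G] [HopfAlgebra ℂ G] [StarModule ℂ G]

/-- The action of a finite quantum group on itself by its comultiplication. -/
def comulAction [CQGAlgebra G] : QuantumAction G G where
  hom := { Bialgebra.comulAlgHom ℂ G with map_star' := CQGAlgebra.comul_star }
  injective := by
    intro x y h
    have h' : Coalgebra.comul (R := ℂ) x = Coalgebra.comul (R := ℂ) y := h
    have h2 := congrArg (TensorProduct.lid ℂ G) (congrArg
      (LinearMap.rTensor G (Coalgebra.counit (R := ℂ) (A := G))) h')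
    simpa using h2
  action_eq := fun x => Coalgebra.coassoc_apply x

variable {G}

/-- The convolution operator `L_ω = (ω ⊗ id) Δ` of a functional `ω`. -/
def convLeft (ω : G →ₗ[ℂ] ℂ) : G →ₗ[ℂ] G :=
  (TensorProduct.lid ℂ G).toLinearMap ∘ₗ TensorProduct.map ω LinearMap.id ∘ₗ Coalgebra.comul

/-- The functional `ψ_x (y) = ψ (x y)`. -/
def psiAt [FiniteQuantumSet G] (x : G) : G →ₗ[ℂ] ℂ :=
  FiniteQuantumSet.psi ∘ₗ LinearMap.mulLeft ℂ x

/-- The operator `A_P = P ⋆ ·` of convolution by `P`, that is `L_{ψ_{S(P)}}` with `S` the antipode: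
for an orthogonal projection `P` this is the adjacency matrix of the quantum Cayley graph of `P`. -/
def cayleyAdjacency [FiniteQuantumSet G] (P : G) : G →ₗ[ℂ] G :=
  convLeft (psiAt (HopfAlgebra.antipode ℂ P))

end FiniteQuantumGroups

/-! ## The dual of a finite group

The dual quantum group `Γ̂` is given by `C(Γ̂) = ℂ[Γ]`, with the usual Hopf algebra structure
`Δ λ_g = λ_g ⊗ λ_g` and the involution `λ_g* = λ_{g⁻¹}`. -/

namespace GroupDual

variable {Γ : Type u} [Group Γ]

/-- The involution of `ℂ[Γ]`: `(∑ c_g λ_g)* = ∑ c̄_g λ_{g⁻¹}`. -/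
instance instStar : Star (MonoidAlgebra ℂ Γ) where
  star x := .ofCoeff ((x.coeff.mapRange star (star_zero ℂ)).mapDomain fun g => g⁻¹)

@[simp]
lemma star_single (g : Γ) (c : ℂ) :
    star (MonoidAlgebra.single g c) = MonoidAlgebra.single g⁻¹ (star c) := by
  apply MonoidAlgebra.coeff_injective
  simp [star]

@[simp]
lemma dual_star_add (x y : MonoidAlgebra ℂ Γ) : star (x + y) = star x + star y := by
  apply MonoidAlgebra.coeff_injective
  change Finsupp.mapDomain _ (Finsupp.mapRange star (star_zero ℂ) (x.coeff + y.coeff)) = _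
  rw [Finsupp.mapRange_add (star_add (R := ℂ)), Finsupp.mapDomain_add]
  rfl

@[simp]
lemma dual_star_zero : star (0 : MonoidAlgebra ℂ Γ) = 0 := by
  apply MonoidAlgebra.coeff_injective
  simp [star]

instance instStarRing : StarRing (MonoidAlgebra ℂ Γ) where
  star_involutive x := by
    induction x using MonoidAlgebra.induction_linear with
    | zero => simp
    | add x y hx hy => rw [dual_star_add, dual_star_add, hx, hy]
    | single g c => simp
  star_mul x y := by
    induction x using MonoidAlgebra.induction_linear with
    | zero => simp
    | add x x' hx hx' => rw [add_mul, dual_star_add, dual_star_add, mul_add, hx, hx']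
    | single g c =>
      induction y using MonoidAlgebra.induction_linear with
      | zero => simp
      | add y y' hy hy' => rw [mul_add, dual_star_add, dual_star_add, add_mul, hy, hy']
      | single h d => simp [MonoidAlgebra.single_mul_single, mul_comm]
  star_add := dual_star_add

instance instStarModule : StarModule ℂ (MonoidAlgebra ℂ Γ) where
  star_smul c x := by
    induction x using MonoidAlgebra.induction_linear with
    | zero => simp
    | add x y hx hy => rw [smul_add, dual_star_add, dual_star_add, smul_add, hx, hy]
    | single g d => simp [MonoidAlgebra.smul_single]

instance instCQGAlgebra : CQGAlgebra (MonoidAlgebra ℂ Γ) where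
  comul_star x := by
    induction x using MonoidAlgebra.induction_linear with
    | zero => simp
    | add x y hx hy => simp only [star_add, map_add, hx, hy]
    | single g c => simp [CommSemiring.comul_apply]
  span_coefficients := by
    rw [eq_top_iff]
    rintro x -
    induction x using MonoidAlgebra.induction_linear with
    | zero => exact Submodule.zero_mem _
    | add x y hx hy => exact Submodule.add_mem _ hx hy
    | single g c =>
      have h : MonoidAlgebra.single g c = c • MonoidAlgebra.single g (1 : ℂ) := by
        simp [MonoidAlgebra.smul_single]
      rw [h]
      refine Submodule.smul_mem _ _ (Submodule.subset_span
        ⟨1, fun _ _ => MonoidAlgebra.single g 1, ⟨?_, ?_, ?_⟩, 0, 0, rfl⟩)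
      · intro i j
        simp
      · ext1 i j
        fin_cases i; fin_cases j
        change ∑ k : Fin 1, MonoidAlgebra.single g (1 : ℂ) * star (MonoidAlgebra.single g (1 : ℂ))
          = 1
        simp [MonoidAlgebra.single_mul_single, MonoidAlgebra.one_def]
      · ext1 i j
        fin_cases i; fin_cases j
        change ∑ k : Fin 1, star (MonoidAlgebra.single g (1 : ℂ)) * MonoidAlgebra.single g (1 : ℂ)
          = 1
        simp [MonoidAlgebra.single_mul_single, MonoidAlgebra.one_def]

/-- The Haar functional of the dual of `Γ`, normalised to be the tracial `1`-form:
`ψ (λ_g) = |Γ|` if `g = 1` and `ψ (λ_g) = 0` otherwise. -/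
def haar (Γ : Type u) [Group Γ] [Fintype Γ] : MonoidAlgebra ℂ Γ →ₗ[ℂ] ℂ :=
  (Fintype.card Γ : ℂ) • (Finsupp.lapply (1 : Γ) ∘ₗ (MonoidAlgebra.coeffLinearEquiv ℂ).toLinearMap)

lemma haar_apply [Fintype Γ] (x : MonoidAlgebra ℂ Γ) :
    haar Γ x = Fintype.card Γ * x.coeff 1 := rfl

/-- The adjoint of the multiplication of `ℂ[Γ]`: `m* λ_g = |Γ|⁻¹ ∑_h λ_h ⊗ λ_{h⁻¹ g}`. -/
def mulAdjoint (Γ : Type u) [Group Γ] [Fintype Γ] :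
    MonoidAlgebra ℂ Γ →ₗ[ℂ] MonoidAlgebra ℂ Γ ⊗[ℂ] MonoidAlgebra ℂ Γ :=
  Finsupp.lsum ℂ (fun g => LinearMap.toSpanSingleton ℂ _ ((Fintype.card Γ : ℂ)⁻¹ • ∑ h : Γ,
      MonoidAlgebra.single h (1 : ℂ) ⊗ₜ[ℂ] MonoidAlgebra.single (h⁻¹ * g) (1 : ℂ)))
    ∘ₗ (MonoidAlgebra.coeffLinearEquiv ℂ).toLinearMap

lemma mulAdjoint_single [Fintype Γ] (g : Γ) (c : ℂ) :
    mulAdjoint Γ (MonoidAlgebra.single g c) = c • (Fintype.card Γ : ℂ)⁻¹ • ∑ h : Γ,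
      MonoidAlgebra.single h (1 : ℂ) ⊗ₜ[ℂ] MonoidAlgebra.single (h⁻¹ * g) (1 : ℂ) := by
  simp [mulAdjoint]

lemma coeff_star (x : MonoidAlgebra ℂ Γ) (g : Γ) : (star x).coeff g = star (x.coeff g⁻¹) := by
  change Finsupp.mapDomain (Equiv.inv Γ) _ g = _
  rw [Finsupp.mapDomain_equiv_apply]
  rfl

lemma coeff_mul_one [Fintype Γ] (x y : MonoidAlgebra ℂ Γ) :
    (x * y).coeff 1 = ∑ g : Γ, x.coeff g * y.coeff g⁻¹ := by
  classical
  induction x using MonoidAlgebra.induction_linear with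
  | zero => simp
  | add x x' hx hx' => simp [add_mul, hx, hx', Finset.sum_add_distrib]
  | single a c =>
    simp [MonoidAlgebra.coeff_single_mul_apply, Finsupp.single_apply]

instance instFiniteQuantumSet [Fintype Γ] : FiniteQuantumSet (MonoidAlgebra ℂ Γ) where
  finite := Module.Finite.equiv (MonoidAlgebra.coeffLinearEquiv ℂ).symm
  psi := haar Γ
  psi_nonneg x := by
    rw [haar_apply, coeff_mul_one]
    refine mul_nonneg (Nat.cast_nonneg _) (Finset.sum_nonneg fun g _ => ?_)
    rw [coeff_star]
    exact star_mul_self_nonneg _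
  psi_faithful x h := by
    rw [haar_apply, coeff_mul_one, mul_eq_zero, or_iff_right (by simp),
      Finset.sum_eq_zero_iff_of_nonneg fun g _ => by
        rw [coeff_star]; exact star_mul_self_nonneg _] at h
    apply MonoidAlgebra.coeff_injective
    ext g
    have := h g⁻¹ (Finset.mem_univ _)
    rw [coeff_star] at this
    simpa using this
  psi_tracial x y := by
    rw [haar_apply, haar_apply, coeff_mul_one, coeff_mul_one]
    congr 1
    refine Fintype.sum_equiv (Equiv.inv Γ) _ _ fun g => ?_
    simp [mul_comm]
  mulAdj := mulAdjoint Γ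
  inner_mulAdj x y z := by
    induction x using MonoidAlgebra.induction_linear with
    | zero => simp
    | add x x' hx hx' => simp only [map_add, star_add, add_mul, hx, hx']
    | single a c =>
      induction y using MonoidAlgebra.induction_linear with
      | zero => simp
      | add y y' hy hy' => simp only [TensorProduct.add_tmul, map_add, mul_add, add_mul, hy, hy']
      | single b d =>
        induction z using MonoidAlgebra.induction_linear with
        | zero => simp
        | add z z' hz hz' => simp only [TensorProduct.tmul_add, map_add, mul_add, hz, hz']
        | single e f =>
          classical
          have h : (Fintype.card Γ : ℂ) ≠ 0 := by simp
          simp only [mulAdjoint_single, star_smul, star_sum, TensorProduct.star_tmul, star_single,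
            Finset.sum_mul, smul_mul_assoc, Algebra.TensorProduct.tmul_mul_tmul,
            MonoidAlgebra.single_mul_single, map_smul, map_sum, TensorProduct.map_tmul,
            LinearMap.mul'_apply, haar_apply, MonoidAlgebra.coeff_single]
          rw [Finset.sum_eq_single b]
          · simp [Finsupp.single_apply, mul_assoc]
            split_ifs <;> ring
          · intro x _ hx
            simp [Finsupp.single_apply, inv_mul_eq_one, hx]
          · simp
  mul_mulAdj x := by
    induction x using MonoidAlgebra.induction_linear with
    | zero => simp
    | add x y hx hy => rw [map_add, map_add, hx, hy]
    | single g c =>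
      have h : (Fintype.card Γ : ℂ) ≠ 0 := by simp
      simp [mulAdjoint_single, MonoidAlgebra.single_mul_single, MonoidAlgebra.smul_single, h]

end GroupDual

end

/-!
The operator `A_P` is diagonal in the basis `λ_g`, with eigenvalues `|Γ| T(g)`. Hence an action
preserving `A_P` maps `λ_g` to `λ_g ⊗ u_g` with `u_g` group-like as soon as `T(g)` differs from all
other values of `T`. If this holds for every `g` outside the center, then such `u_g` exist for the
central `g` as well, which are products of two noncentral elements, and the action is obtained from
`Δ` through `λ_g ↦ u_g`.

A projection whose Fourier transform separates enough elements exists by genericity. Let `P` be the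
sum of the projections onto lines `ℂ w_i`, one in each block of dimension greater than one. Then
`|Γ| (T(g) - T(h)) = ψ(P a)` for `a = λ_{g⁻¹} - λ_{h⁻¹}`, which is a real analytic function of the
nonzero vectors `w_i`, and these form a connected set. If `g` and `h` are distinct and not both
central, then `a` is not central, so it is not a scalar in some block and the function is not
identically zero. Finitely many such functions have a common point where none of them vanishes.

For `P` to be an orthogonal projection, the block decomposition must respect the involution: in each
block, conjugation by a square root of the Gram matrix of `ψ` on a column achieves this.
-/

open scoped Matrix

lemma exists_forall_ne_zero_of_analyticOnNhd {𝕜 E F J : Type*} [NontriviallyNormedField 𝕜]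
    [NormedAddCommGroup E] [NormedSpace 𝕜 E] [NormedAddCommGroup F] [NormedSpace 𝕜 F] [Finite J]
    {U : Set E} (hUo : IsOpen U) (hU : IsConnected U) {f : J → E → F}
    (hf : ∀ j, AnalyticOnNhd 𝕜 (f j) U) (hne : ∀ j, ∃ x ∈ U, f j x ≠ 0) :
    ∃ x ∈ U, ∀ j, f j x ≠ 0 := by
  classical
  have := Fintype.ofFinite J
  suffices ∀ s : Finset J, ∃ x ∈ U, ∀ j ∈ s, f j x ≠ 0 by simpa using this Finset.univ
  intro s
  induction s using Finset.induction_on with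
  | empty => exact hU.nonempty.imp fun x hx => ⟨hx, by simp⟩
  | insert j s _ ih =>
    obtain ⟨x, hxU, hx⟩ := ih
    have near : ∀ᶠ y in nhds x, y ∈ U ∧ ∀ i ∈ s, f i y ≠ 0 :=
      (hUo.eventually_mem hxU).and <| (Filter.eventually_all_finset s).2
        fun i hi => (hf i x hxU).continuousAt.eventually_ne (hx i hi)
    have often : ∃ᶠ y in nhds x, f j y ≠ 0 := fun h => by
      obtain ⟨z, hzU, hz⟩ := hne j
      exact hz ((hf j).eqOn_zero_of_preconnected_of_eventuallyEq_zero hU.isPreconnected hxU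
        (h.mono fun _ => not_not.1) hzU)
    obtain ⟨y, ⟨hyU, hys⟩, hyj⟩ := (near.and_frequently often).exists
    exact ⟨y, hyU, Finset.forall_mem_insert _ _ _ |>.2 ⟨hyj, hys⟩⟩

section RankOneProj

variable {n : Type*} [Fintype n]

/-- The orthogonal projection of `ℂⁿ` onto the line spanned by `w`, or `0` if `w = 0`. -/
noncomputable def rankOneProj (w : n → ℂ) : Matrix n n ℂ :=
  (star w ⬝ᵥ w)⁻¹ • Matrix.vecMulVec w (star w)

lemma star_dotProduct_self_ne_zero {w : n → ℂ} (hw : w ≠ 0) : star w ⬝ᵥ w ≠ 0 :=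
  (Matrix.dotProduct_star_self_pos_iff.2 hw).ne'

lemma isStarProjection_rankOneProj (w : n → ℂ) : IsStarProjection (rankOneProj w) where
  isIdempotentElem := by
    rcases eq_or_ne w 0 with rfl | hw
    · simp [rankOneProj, IsIdempotentElem]
    · simp [rankOneProj, IsIdempotentElem, Matrix.vecMulVec_mul_vecMulVec, smul_smul,
        star_dotProduct_self_ne_zero hw]
  isSelfAdjoint := by
    have h : star (star w ⬝ᵥ w) = star w ⬝ᵥ w := by simp [← Matrix.star_dotProduct_star]
    simp only [rankOneProj, IsSelfAdjoint, star_smul, star_inv₀, h, Matrix.star_eq_conjTranspose,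
      Matrix.conjTranspose_vecMulVec, star_star]

lemma rankOneProj_mulVec_self (w : n → ℂ) : rankOneProj w *ᵥ w = w := by
  rcases eq_or_ne w 0 with rfl | hw
  · simp
  · simp [rankOneProj, Matrix.smul_mulVec, Matrix.vecMulVec_mulVec, smul_smul,
      star_dotProduct_self_ne_zero hw]

lemma rank_rankOneProj {w : n → ℂ} (hw : w ≠ 0) : (rankOneProj w).rank = 1 := by
  refine le_antisymm ?_ (Submodule.one_le_finrank_iff.2 ?_)
  · rw [rankOneProj, ← Matrix.smul_vecMulVec]
    exact Matrix.rank_vecMulVec_le _ _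
  · exact Submodule.ne_bot_iff _ |>.2 ⟨w, ⟨w, rankOneProj_mulVec_self w⟩, hw⟩

lemma trace_rankOneProj_mul (w : n → ℂ) (M : Matrix n n ℂ) :
    (rankOneProj w * M).trace = (star w ⬝ᵥ w)⁻¹ * (star w ⬝ᵥ M *ᵥ w) := by
  rw [rankOneProj, Matrix.smul_mul, Matrix.trace_smul, Matrix.vecMulVec_mul,
    Matrix.trace_vecMulVec, dotProduct_comm w (star w ᵥ* M), ← Matrix.dotProduct_mulVec,
    smul_eq_mul]

lemma eq_zero_of_star_dotProduct_mulVec_eq_zero {M : Matrix n n ℂ}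
    (h : ∀ w : n → ℂ, star w ⬝ᵥ M *ᵥ w = 0) : M = 0 := by
  classical
  rw [← (Matrix.toEuclideanLin (𝕜 := ℂ) (m := n) (n := n)).map_eq_zero_iff,
    ← inner_map_self_eq_zero]
  intro x
  rw [← inner_conj_symm, EuclideanSpace.inner_eq_star_dotProduct, dotProduct_comm]
  simpa using h x.ofLp

lemma eq_scalar_of_trace_rankOneProj_mul_eq [DecidableEq n] {M : Matrix n n ℂ} {c : ℂ}
    (h : ∀ w ≠ 0, (rankOneProj w * M).trace = c) : M = Matrix.scalar n c := by
  rw [← sub_eq_zero]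
  refine eq_zero_of_star_dotProduct_mulVec_eq_zero fun w => ?_
  rcases eq_or_ne w 0 with rfl | hw
  · simp
  · have hwM := h w hw
    rw [trace_rankOneProj_mul, inv_mul_eq_iff_eq_mul₀ (star_dotProduct_self_ne_zero hw)] at hwM
    simp [Matrix.sub_mulVec, hwM, mul_comm, ← Matrix.smul_one_eq_diagonal, Matrix.smul_mulVec]

lemma analyticAt_trace_rankOneProj_mul (M : Matrix n n ℂ) {w : n → ℂ} (hw : w ≠ 0) :
    AnalyticAt ℝ (fun w => (rankOneProj w * M).trace) w := by
  have coord : ∀ i, AnalyticAt ℝ (fun w : n → ℂ => w i) w := fun i =>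
    (ContinuousLinearMap.proj (R := ℝ) (φ := fun _ => ℂ) i).analyticAt w
  have conj_coord : ∀ i, AnalyticAt ℝ (fun w : n → ℂ => star (w i)) w := fun i =>
    (Complex.conjCLE.toContinuousLinearMap.analyticAt _).comp (coord i)
  have mulVec_coord : ∀ i, AnalyticAt ℝ (fun w : n → ℂ => (M *ᵥ w) i) w := fun i =>
    Finset.analyticAt_fun_sum _ fun j _ => analyticAt_const.mul (coord j)
  simp only [trace_rankOneProj_mul]
  exact ((Finset.analyticAt_fun_sum _ fun i _ => (conj_coord i).mul (coord i)).inv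
    (star_dotProduct_self_ne_zero hw)).mul
      (Finset.analyticAt_fun_sum _ fun i _ => (conj_coord i).mul (mulVec_coord i))

end RankOneProj

section Blocks

variable {ι : Type*} {n : ι → Type*} [∀ i, Nonempty (n i)]

lemma isConnected_univ_pi_compl_zero [∀ i, Finite (n i)] :
    IsConnected (Set.univ.pi fun i => ({0}ᶜ : Set (n i → ℂ))) := by
  have (i : ι) := Fintype.ofFinite (n i)
  refine isConnected_univ_pi.2 fun i => isConnected_compl_singleton_of_one_lt_rank ?_ 0
  rw [rank_real_of_complex, rank_fun']
  exact_mod_cast (by have := Fintype.card_pos (α := n i); omega : 1 < 2 * Fintype.card (n i))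

variable [Fintype ι] [∀ i, Fintype (n i)] [∀ i, DecidableEq (n i)]

lemma exists_sum_trace_rankOneProj_mul_ne_zero {κ : ι → ℂ}
    {a : ∀ i, Matrix (n i) (n i) ℂ}
    (ha : ∃ i, κ i ≠ 0 ∧ a i ∉ Set.range (Matrix.scalar (n i))) :
    ∃ w : ∀ i, n i → ℂ, (∀ i, w i ≠ 0) ∧ ∑ i, κ i * (rankOneProj (w i) * a i).trace ≠ 0 := by
  classical
  obtain ⟨i, hκ, hai⟩ := ha
  by_contra! vanish
  let w : ∀ i, n i → ℂ := fun _ => 1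
  refine hai ⟨_, (eq_scalar_of_trace_rankOneProj_mul_eq (c := -(κ i)⁻¹ *
    ∑ k ∈ Finset.univ.erase i, κ k * (rankOneProj (w k) * a k).trace) fun v hv => ?_).symm⟩
  have h := vanish (Function.update w i v) fun k => by
    rcases eq_or_ne k i with rfl | hk
    · simpa
    · simp [hk, w]
  rw [← Finset.add_sum_erase _ _ (Finset.mem_univ i), Function.update_self,
    Finset.sum_congr rfl fun k hk => by rw [Function.update_of_ne (Finset.ne_of_mem_erase hk)]] at h
  rw [neg_mul, eq_neg_iff_add_eq_zero, ← mul_right_inj' hκ, mul_add, mul_inv_cancel_left₀ hκ, h,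
    mul_zero]

lemma exists_forall_sum_trace_rankOneProj_mul_ne_zero {J : Type*} [Finite J] {κ : ι → ℂ}
    {a : J → ∀ i, Matrix (n i) (n i) ℂ}
    (ha : ∀ j, ∃ i, κ i ≠ 0 ∧ a j i ∉ Set.range (Matrix.scalar (n i))) :
    ∃ w : ∀ i, n i → ℂ, (∀ i, w i ≠ 0) ∧
      ∀ j, ∑ i, κ i * (rankOneProj (w i) * a j i).trace ≠ 0 := by
  have analytic_coord (i : ι) (w : ∀ i, n i → ℂ) : AnalyticAt ℝ (fun w => w i) w :=
    (ContinuousLinearMap.proj (R := ℝ) (φ := fun i => n i → ℂ) i).analyticAt w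
  have analytic (j : J) : AnalyticOnNhd ℝ
      (fun w : ∀ i, n i → ℂ => ∑ i, κ i * (rankOneProj (w i) * a j i).trace)
      (Set.univ.pi fun i => ({0}ᶜ : Set (n i → ℂ))) := fun w hw => by
    refine Finset.analyticAt_fun_sum _ fun i _ => analyticAt_const.mul ?_
    exact AnalyticAt.fun_comp (g := fun v => (rankOneProj v * a j i).trace)
      (analyticAt_trace_rankOneProj_mul (a j i) (hw i trivial)) (analytic_coord i w)
  obtain ⟨w, hw, hne⟩ := exists_forall_ne_zero_of_analyticOnNhd
    (isOpen_set_pi Set.finite_univ fun _ _ => isOpen_compl_singleton)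
    isConnected_univ_pi_compl_zero analytic
    fun j => (exists_sum_trace_rankOneProj_mul_ne_zero (ha j)).imp
      fun w hw => ⟨fun i _ => hw.1 i, hw.2⟩
  exact ⟨w, fun i => hw i trivial, hne⟩

end Blocks

lemma eq_zero_of_isSelfAdjoint_of_isNilpotent {A : Type*} [Ring A] [StarRing A]
    (hA : ∀ x : A, star x * x = 0 → x = 0) {x : A} (hx : IsSelfAdjoint x) (hn : IsNilpotent x) :
    x = 0 := by
  nontriviality A
  by_contra hx0
  have two_le : 2 ≤ nilpotencyClass x := by
    have h0 : nilpotencyClass x ≠ 0 := (pos_nilpotencyClass_iff.2 hn).ne'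
    have h1 : nilpotencyClass x ≠ 1 := fun h => hx0 (by simpa [h] using pow_nilpotencyClass hn)
    omega
  refine pow_pred_nilpotencyClass hn (hA _ ?_)
  rw [(hx.pow _).star_eq, ← pow_add]
  exact pow_eq_zero_of_le (by omega) (pow_nilpotencyClass hn)

lemma isSemisimpleRing_of_star_mul_self_eq_zero {A : Type*} [Ring A] [StarRing A]
    [IsArtinianRing A] (hA : ∀ x : A, star x * x = 0 → x = 0) : IsSemisimpleRing A := by
  refine IsArtinianRing.isSemisimpleRing_iff_jacobson.2 ((Submodule.eq_bot_iff _).2 fun x hx => ?_)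
  obtain ⟨k, hk⟩ := IsArtinianRing.isNilpotent_jacobson_bot (R := A)
  rw [Ideal.jacobson_bot] at hk
  have hmem : star x * x ∈ Ring.jacobson A := Ideal.mul_mem_left _ _ hx
  have nilp : IsNilpotent (star x * x) := ⟨k, by simpa [hk] using Ideal.pow_mem_pow hmem k⟩
  exact hA x (eq_zero_of_isSelfAdjoint_of_isNilpotent hA (.star_mul_self x) nilp)

lemma nonempty_starAlgEquiv_of_star_mul_eq {R A C : Type*} [CommSemiring R] [Ring A] [StarRing A]
    [Algebra R A] [Ring C] [StarRing C] [Algebra R C] (f : A ≃ₐ[R] C) {s : C} (hs : IsUnit s)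
    (h : ∀ a, star (f a) * (star s * s) = star s * s * f (star a)) : Nonempty (A ≃⋆ₐ[R] C) := by
  obtain ⟨s, rfl⟩ := hs
  refine ⟨.ofAlgEquiv (f.trans (MulSemiringAction.toAlgEquiv R C (ConjAct.toConjAct s)))
    fun a => ?_⟩
  have hfa : f (star a) = ↑s⁻¹ * star (↑s⁻¹ : C) * star (f a) * star (s : C) * s := by
    have hstar : star (↑s⁻¹ : C) * star (s : C) = 1 := by rw [← star_mul, s.mul_inv, star_one]
    rw [mul_assoc, mul_assoc, h a, ← mul_assoc, ← mul_assoc, mul_assoc (↑s⁻¹ : C), hstar,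
      mul_one, Units.inv_mul, one_mul]
  simp [ConjAct.units_smul_def, hfa, ← mul_assoc]

lemma posDef_of_forall_pos {n : Type*} [Fintype n] {M : Matrix n n ℂ}
    (hM : ∀ w : n → ℂ, w ≠ 0 → 0 < star w ⬝ᵥ M *ᵥ w) : M.PosDef := by
  refine Matrix.posDef_iff_dotProduct_mulVec.2 ⟨?_, hM⟩
  refine sub_eq_zero.1 (eq_zero_of_star_dotProduct_mulVec_eq_zero fun w => ?_)
  have real : IsSelfAdjoint (star w ⬝ᵥ M *ᵥ w) := by
    rcases eq_or_ne w 0 with rfl | hw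
    · simp
    · exact (hM w hw).le.isSelfAdjoint
  rw [Matrix.sub_mulVec, dotProduct_sub, sub_eq_zero]
  calc star w ⬝ᵥ Mᴴ *ᵥ w = star (star w ⬝ᵥ M *ᵥ w) := by
        rw [← Matrix.star_dotProduct_star, star_star, Matrix.star_mulVec,
          ← Matrix.dotProduct_mulVec]
    _ = star w ⬝ᵥ M *ᵥ w := real

section Gram

variable {A : Type*} [Ring A] [StarRing A] [Algebra ℂ A] [StarModule ℂ A]
  {n : Type*} [DecidableEq n]

/-- The Gram matrix of the vectors `c eₚ` for the sesquilinear form `(x, y) ↦ ψ (x* y)`. -/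
noncomputable def gramMatrix (ψ : A →ₗ[ℂ] ℂ) (c : (n → ℂ) →ₗ[ℂ] A) : Matrix n n ℂ :=
  .of fun p q => ψ (star (c (Pi.single p 1)) * c (Pi.single q 1))

lemma star_dotProduct_gramMatrix_mulVec [Fintype n] (ψ : A →ₗ[ℂ] ℂ)
    (c : (n → ℂ) →ₗ[ℂ] A) (u v : n → ℂ) :
    star u ⬝ᵥ gramMatrix ψ c *ᵥ v = ψ (star (c u) * c v) := by
  have expand (w : n → ℂ) : c w = ∑ p, w p • c (Pi.single p 1) := by
    conv_lhs => rw [pi_eq_sum_univ' w]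
    simp
  rw [expand u, expand v, star_sum, Finset.sum_mul_sum, map_sum]
  refine Finset.sum_congr rfl fun p _ => ?_
  rw [map_sum, Matrix.mulVec, dotProduct, Finset.mul_sum]
  refine Finset.sum_congr rfl fun q _ => ?_
  simp only [gramMatrix, Matrix.of_apply, Pi.star_apply, star_smul, smul_mul_smul_comm, map_smul,
    smul_eq_mul]
  ring

lemma posDef_gramMatrix [Finite n] {ψ : A →ₗ[ℂ] ℂ} (hψ : ∀ x, x ≠ 0 → 0 < ψ (star x * x))
    {c : (n → ℂ) →ₗ[ℂ] A} (hc : Function.Injective c) : (gramMatrix ψ c).PosDef := by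
  have := Fintype.ofFinite n
  refine posDef_of_forall_pos fun w hw => ?_
  rw [star_dotProduct_gramMatrix_mulVec]
  exact hψ _ ((map_ne_zero_iff c hc).2 hw)

end Gram

lemma exists_isUnit_star_mul_self_of_posDef {n : Type*} [Fintype n] [DecidableEq n]
    {M : Matrix n n ℂ} (hM : M.PosDef) : ∃ s : Matrix n n ℂ, IsUnit s ∧ M = star s * s := by
  open scoped MatrixOrder in
  open scoped Matrix.Norms.L2Operator in
  exact CStarAlgebra.isStrictlyPositive_iff_eq_star_mul_self.1 hM.isStrictlyPositive

section BlockColumn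

variable {K A : Type*} [CommRing K] [Ring A] [Algebra K A] {ι : Type*} [DecidableEq ι]
  {n : ι → Type*} [∀ i, Fintype (n i)] [∀ i, DecidableEq (n i)]

/-- The element of a multimatrix algebra `A` whose block `i` has `v` as its `k`-th column, all other
entries of all blocks being `0`. For fixed `i` and `k` these elements form a left ideal of `A`
isomorphic to the representation of `A` on column vectors through the block `i`. -/
noncomputable def blockColumn (φ : A ≃ₐ[K] ∀ i, Matrix (n i) (n i) K) (i : ι) (k : n i) :
    (n i → K) →ₗ[K] A where
  toFun v := φ.symm (Pi.single i (Matrix.vecMulVec v (Pi.single k 1)))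
  map_add' u v := by rw [Matrix.add_vecMulVec, Pi.single_add, map_add]
  map_smul' c v := by rw [Matrix.smul_vecMulVec, Pi.single_smul, map_smul, RingHom.id_apply]

variable (φ : A ≃ₐ[K] ∀ i, Matrix (n i) (n i) K) (i : ι) (k : n i)

lemma apply_blockColumn (v : n i → K) :
    φ (blockColumn φ i k v) = Pi.single i (Matrix.vecMulVec v (Pi.single k 1)) :=
  φ.apply_symm_apply _

lemma mul_blockColumn (a : A) (v : n i → K) :
    a * blockColumn φ i k v = blockColumn φ i k (φ a i *ᵥ v) := by
  apply φ.injective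
  rw [map_mul, apply_blockColumn, apply_blockColumn, ← Matrix.mul_vecMulVec]
  exact (Pi.single_mul_right _).symm

lemma blockColumn_injective : Function.Injective (blockColumn φ i k) := by
  intro u v huv
  have hφ := congrArg φ huv
  rw [apply_blockColumn, apply_blockColumn] at hφ
  ext p
  simpa [Matrix.vecMulVec_apply] using congr($(Pi.single_injective i hφ) p k)

lemma sum_blockColumn_single [Fintype ι] :
    ∑ i, ∑ k, blockColumn φ i k (Pi.single k 1) = 1 := by
  refine φ.injective ?_
  simp only [map_sum, map_one, apply_blockColumn, ← Matrix.single_eq_single_vecMulVec_single]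
  refine (Finset.sum_congr rfl fun i _ => ?_).trans (Finset.univ_sum_single 1)
  rw [Pi.one_apply, ← Matrix.sum_single_one]
  exact (map_sum (LinearMap.single K (fun i => Matrix (n i) (n i) K) i) _ _).symm

end BlockColumn

section StarEquiv

variable {A : Type*} [Ring A] [StarRing A] [Algebra ℂ A] [StarModule ℂ A] {ι : Type*}
  {n : ι → Type*} [∀ i, Fintype (n i)] [∀ i, DecidableEq (n i)] [∀ i, Nonempty (n i)]

lemma exists_posDef_star_mul_eq {ψ : A →ₗ[ℂ] ℂ} (hψ : ∀ x, x ≠ 0 → 0 < ψ (star x * x))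
    (φ : A ≃ₐ[ℂ] ∀ i, Matrix (n i) (n i) ℂ) (i : ι) :
    ∃ G : Matrix (n i) (n i) ℂ, G.PosDef ∧ ∀ a, star (φ a i) * G = G * φ (star a) i := by
  classical
  obtain ⟨k⟩ := ‹∀ i, Nonempty (n i)› i
  refine ⟨gramMatrix ψ (blockColumn φ i k), posDef_gramMatrix hψ (blockColumn_injective φ i k),
    fun a => sub_eq_zero.1 (eq_zero_of_star_dotProduct_mulVec_eq_zero fun w => ?_)⟩
  have adjoint : star w ⬝ᵥ star (φ a i) *ᵥ gramMatrix ψ (blockColumn φ i k) *ᵥ w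
      = star w ⬝ᵥ gramMatrix ψ (blockColumn φ i k) *ᵥ φ (star a) i *ᵥ w := by
    rw [Matrix.dotProduct_mulVec, Matrix.star_eq_conjTranspose, ← Matrix.star_mulVec]
    simp only [star_dotProduct_gramMatrix_mulVec, ← mul_blockColumn, star_mul, mul_assoc]
  rw [Matrix.sub_mulVec, dotProduct_sub, ← Matrix.mulVec_mulVec, ← Matrix.mulVec_mulVec, adjoint,
    sub_self]

lemma nonempty_starAlgEquiv_pi_matrix {ψ : A →ₗ[ℂ] ℂ} (hψ : ∀ x, x ≠ 0 → 0 < ψ (star x * x))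
    (φ : A ≃ₐ[ℂ] ∀ i, Matrix (n i) (n i) ℂ) :
    Nonempty (A ≃⋆ₐ[ℂ] ∀ i, Matrix (n i) (n i) ℂ) := by
  choose G hG hGφ using exists_posDef_star_mul_eq hψ φ
  choose s hs hGs using fun i => exists_isUnit_star_mul_self_of_posDef (hG i)
  obtain rfl : G = star s * s := funext hGs
  exact nonempty_starAlgEquiv_of_star_mul_eq φ (Pi.isUnit_iff.2 hs) fun a => funext (hGφ · a)

end StarEquiv

section Trace

variable {R : Type*} [CommSemiring R]

lemma exists_eq_mul_trace {n : Type*} [Fintype n] {f : Matrix n n R →ₗ[R] R}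
    (hf : ∀ M N, f (M * N) = f (N * M)) : ∃ c, ∀ M, f M = c * M.trace := by
  classical
  obtain _ | ⟨⟨k⟩⟩ := isEmpty_or_nonempty n
  · exact ⟨0, fun M => by rw [Subsingleton.elim M 0, map_zero, zero_mul]⟩
  refine ⟨f (.single k k 1), fun M => ?_⟩
  suffices f = f (.single k k 1) • Matrix.traceLinearMap n R R from congr($this M)
  refine Matrix.ext_linearMap _ fun i j => LinearMap.ext_ring ?_
  have comm := hf (.single i k 1) (.single k j 1)
  rw [Matrix.single_mul_single_same, one_mul] at comm
  rcases eq_or_ne i j with rfl | hij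
  · simpa using comm
  · simpa [hij, hij.symm] using comm

lemma exists_eq_sum_mul_trace {ι : Type*} [Fintype ι] {n : ι → Type*} [∀ i, Fintype (n i)]
    {f : (∀ i, Matrix (n i) (n i) R) →ₗ[R] R}
    (hf : ∀ a b, f (a * b) = f (b * a)) : ∃ κ : ι → R, ∀ a, f a = ∑ i, κ i * (a i).trace := by
  classical
  choose κ hκ using fun i => exists_eq_mul_trace
    (f := f ∘ₗ LinearMap.single R (fun i => Matrix (n i) (n i) R) i)
    fun M N => by simpa [Pi.single_mul] using hf (Pi.single i M) (Pi.single i N)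
  refine ⟨κ, fun a => ?_⟩
  conv_lhs => rw [← Finset.univ_sum_single a, map_sum]
  exact Finset.sum_congr rfl fun i _ => hκ i (a i)

end Trace

lemma mem_range_scalar_of_card_le_one {R n : Type*} [CommSemiring R] [Fintype n] [DecidableEq n]
    (hn : Fintype.card n ≤ 1) (M : Matrix n n R) : M ∈ Set.range (Matrix.scalar n) := by
  have := Fintype.card_le_one_iff_subsingleton.1 hn
  obtain _ | ⟨⟨i⟩⟩ := isEmpty_or_nonempty n
  · exact ⟨0, Subsingleton.elim _ _⟩
  · refine ⟨M i i, Matrix.ext fun j k => ?_⟩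
    simp [Subsingleton.elim j i, Subsingleton.elim k i]

lemma exists_notMem_range_scalar {A R : Type*} [CommSemiring R] [Semiring A] [Algebra R A]
    {ι : Type*} {n : ι → Type*} [∀ i, Fintype (n i)] [∀ i, DecidableEq (n i)]
    (φ : A ≃ₐ[R] ∀ i, Matrix (n i) (n i) R) {a : A} (ha : a ∉ Subalgebra.center R A) :
    ∃ i, φ a i ∉ Set.range (Matrix.scalar (n i)) := by
  contrapose! ha
  refine Subalgebra.mem_center_iff.2 fun b => φ.injective ?_
  rw [map_mul, map_mul]
  ext1 i
  obtain ⟨c, hc⟩ := ha i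
  rw [Pi.mul_apply, Pi.mul_apply, ← hc]
  exact (Matrix.scalar_comm c (.all _) _).symm

namespace FiniteQuantumSet

variable {B : Type*} [Ring B] [StarRing B] [Algebra ℂ B] [StarModule ℂ B] [FiniteQuantumSet B]

lemma psi_pos {x : B} (hx : x ≠ 0) : 0 < psi (star x * x) :=
  (psi_nonneg x).lt_of_ne fun h => hx (psi_faithful x h.symm)

variable (B) in
lemma exists_starAlgEquiv_pi_matrix :
    ∃ (m : ℕ) (d : Fin m → ℕ), (∀ i, NeZero (d i)) ∧
      Nonempty (B ≃⋆ₐ[ℂ] ∀ i, Matrix (Fin (d i)) (Fin (d i)) ℂ) := by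
  have : FiniteDimensional ℂ B := finite
  have : IsArtinianRing B := IsArtinianRing.of_finite ℂ B
  have : IsSemisimpleRing B := isSemisimpleRing_of_star_mul_self_eq_zero fun x hx =>
    psi_faithful x (by rw [hx, map_zero])
  obtain ⟨m, d, hd, ⟨φ⟩⟩ := IsSemisimpleRing.exists_algEquiv_pi_matrix_of_isAlgClosed ℂ B
  exact ⟨m, d, hd, nonempty_starAlgEquiv_pi_matrix (fun x => psi_pos) φ⟩

variable {ι : Type*} {n : ι → Type*} [∀ i, Fintype (n i)] [∀ i, Nonempty (n i)]

lemma exists_psi_eq_sum_mul_trace [Fintype ι]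
    (φ : B ≃⋆ₐ[ℂ] ∀ i, Matrix (n i) (n i) ℂ) :
    ∃ κ : ι → ℂ, (∀ i, κ i ≠ 0) ∧ ∀ a : B, psi a = ∑ i, κ i * (φ a i).trace := by
  classical
  obtain ⟨κ, hκ⟩ := exists_eq_sum_mul_trace (f := psi ∘ₗ φ.symm.toAlgEquiv.toLinearMap)
    fun a b => by simpa using psi_tracial (φ.symm a) (φ.symm b)
  have hψ (a : B) : psi a = ∑ i, κ i * (φ a i).trace := by simpa using hκ (φ a)
  refine ⟨κ, fun i hi => ?_, hψ⟩
  have hne : φ.symm (Pi.single i 1) ≠ 0 := by simp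
  have hstar : star (φ.symm (Pi.single i 1)) * φ.symm (Pi.single i 1)
      = φ.symm (Pi.single i 1) := by
    rw [← map_star, ← map_mul, ← Pi.single_star, star_one, ← Pi.single_mul, one_mul]
  refine (psi_pos hne).ne' ?_
  rw [hstar, hψ, Finset.sum_eq_zero]
  intro j _
  rcases eq_or_ne j i with rfl | hj
  · rw [hi, zero_mul]
  · simp [hj]

lemma exists_isStarProjection_psi_mul_ne_zero [Finite ι] {J : Type*} [Finite J]
    (φ : B ≃⋆ₐ[ℂ] ∀ i, Matrix (n i) (n i) ℂ) {a : J → B}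
    (ha : ∀ j, a j ∉ Subalgebra.center ℂ B) :
    ∃ P, IsStarProjection P ∧ (∀ i, (φ P i).rank = if 1 < Fintype.card (n i) then 1 else 0) ∧
      ∀ j, psi (P * a j) ≠ 0 := by
  classical
  have := Fintype.ofFinite ι
  obtain ⟨κ, hκ, hψ⟩ := exists_psi_eq_sum_mul_trace φ
  obtain ⟨w, hw, hne⟩ := exists_forall_sum_trace_rankOneProj_mul_ne_zero
    (κ := fun i => if 1 < Fintype.card (n i) then κ i else 0) (a := fun j => φ (a j)) fun j => by
      obtain ⟨i, hi⟩ := exists_notMem_range_scalar φ.toAlgEquiv (ha j)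
      refine ⟨i, ?_, hi⟩
      rw [if_pos, ne_eq]
      · exact hκ i
      · contrapose! hi
        exact mem_range_scalar_of_card_le_one hi _
  let Q (i : ι) : Matrix (n i) (n i) ℂ := if 1 < Fintype.card (n i) then rankOneProj (w i) else 0
  have isStarProjection_block (i : ι) : IsStarProjection (Q i) := by
    simp only [Q]
    split_ifs
    · exact isStarProjection_rankOneProj _
    · exact .zero _
  have hQ : IsStarProjection Q := ⟨funext fun i => (isStarProjection_block i).isIdempotentElem,
    funext fun i => (isStarProjection_block i).isSelfAdjoint⟩
  refine ⟨φ.symm Q, hQ.map φ.symm, fun i => ?_, fun j => ?_⟩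
  · rw [StarAlgEquiv.apply_symm_apply]
    simp only [Q]
    split_ifs
    · exact rank_rankOneProj (hw i)
    · exact Matrix.rank_zero
  · convert hne j using 1
    rw [hψ]
    refine Finset.sum_congr rfl fun i _ => ?_
    simp only [map_mul, StarAlgEquiv.apply_symm_apply, Pi.mul_apply, Q]
    split_ifs <;> simp

end FiniteQuantumSet

section SimpleModule

variable {K A : Type*} [Field K] [Ring A] [Algebra K A] {ι : Type*} [Finite ι]
  {n : ι → Type*} [∀ i, Fintype (n i)] [∀ i, DecidableEq (n i)] (V : Type*) [AddCommGroup V]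
  [Module K V] [Module A V] [IsScalarTower K A V] [IsSimpleModule A V]

lemma exists_linearEquiv_mulVec_eq_smul (φ : A ≃ₐ[K] ∀ i, Matrix (n i) (n i) K) :
    ∃ i, ∃ T : (n i → K) ≃ₗ[K] V, ∀ a u, T (φ a i *ᵥ u) = a • T u := by
  classical
  have := Fintype.ofFinite ι
  have := IsSimpleModule.nontrivial A V
  obtain ⟨v, hv⟩ := exists_ne (0 : V)
  obtain ⟨i, k, hik⟩ : ∃ i k, blockColumn φ i k (Pi.single k 1) • v ≠ 0 := by
    by_contra! h
    refine hv ?_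
    rw [← one_smul A v, ← sum_blockColumn_single φ, Finset.sum_smul]
    exact Finset.sum_eq_zero fun i _ => by
      rw [Finset.sum_smul]; exact Finset.sum_eq_zero fun k _ => h i k
  let T : (n i → K) →ₗ[K] V :=
    ((LinearMap.toSpanSingleton A V v).restrictScalars K) ∘ₗ blockColumn φ i k
  have hT (a : A) (u : n i → K) : T (φ a i *ᵥ u) = a • T u := by
    simp [T, ← mul_blockColumn, mul_smul]
  have injective : Function.Injective T := by
    refine LinearMap.ker_eq_bot.1 ((Submodule.eq_bot_iff _).2 fun u hu => ?_)
    ext p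
    by_contra hp
    refine hik ?_
    have hcol : T (Pi.single k 1) = blockColumn φ i p (Pi.single k (u p)⁻¹) • T u := by
      rw [← hT, apply_blockColumn, Pi.single_eq_same, Matrix.vecMulVec_mulVec]
      congr 1
      ext q
      simp [Pi.single_apply, inv_mul_cancel₀ hp]
    exact hcol.trans (by rw [hu, smul_zero])
  have surjective : Function.Surjective T := fun x => by
    obtain ⟨a, ha⟩ := IsSimpleModule.toSpanSingleton_surjective A hik x
    exact ⟨φ a i *ᵥ Pi.single k 1, (hT a _).trans ha⟩
  exact ⟨i, .ofBijective T ⟨injective, surjective⟩, hT⟩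

lemma exists_finrank_range_lsmul_eq_rank (φ : A ≃ₐ[K] ∀ i, Matrix (n i) (n i) K) :
    ∃ i, Module.finrank K V = Fintype.card (n i) ∧
      ∀ a : A, Module.finrank K (LinearMap.range (Algebra.lsmul K K V a)) = (φ a i).rank := by
  obtain ⟨i, T, hT⟩ := exists_linearEquiv_mulVec_eq_smul V φ
  refine ⟨i, by rw [← T.finrank_eq, Module.finrank_fintype_fun_eq_card], fun a => ?_⟩
  have conj : Algebra.lsmul K K V a ∘ₗ T.toLinearMap = T.toLinearMap ∘ₗ (φ a i).mulVecLin :=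
    LinearMap.ext fun u => (hT a u).symm
  rw [← LinearMap.range_comp_of_range_eq_top _ T.range, conj, LinearMap.range_comp, Matrix.rank]
  exact LinearEquiv.finrank_map_eq T _

end SimpleModule

lemma exists_finrank_range_asAlgebraHom_eq_rank {K Γ : Type*} [Field K] [Group Γ] {ι : Type*}
    [Finite ι] {n : ι → Type*} [∀ i, Fintype (n i)] [∀ i, DecidableEq (n i)]
    (φ : MonoidAlgebra K Γ ≃ₐ[K] ∀ i, Matrix (n i) (n i) K) {V : Type*} [AddCommGroup V]
    [Module K V] (ρ : Representation K Γ V) [ρ.IsIrreducible] :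
    ∃ i, Module.finrank K V = Fintype.card (n i) ∧
      ∀ a, Module.finrank K (LinearMap.range (ρ.asAlgebraHom a)) = (φ a i).rank :=
  exists_finrank_range_lsmul_eq_rank ρ.asModule φ

lemma isGroupLikeElem_of_comul_eq_tmul_self {K C : Type*} [Field K] [AddCommGroup C] [Module K C]
    [Coalgebra K C] {u : C} (hu : u ≠ 0) (h : Coalgebra.comul (R := K) u = u ⊗ₜ u) :
    IsGroupLikeElem K u where
  counit_eq_one := by
    have hsmul : Coalgebra.counit (R := K) u • u = u := by
      simpa [h] using congrArg (TensorProduct.lid K C) (Coalgebra.rTensor_counit_comul (R := K) u)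
    exact smul_left_injective K hu (by simpa using hsmul)
  comul_eq_tmul_self := h

section Center

variable {R Γ : Type*} [CommRing R] [NeZero (2 : R)] [Group Γ]

lemma mem_center_of_single_sub_single_mem_center {a b : Γ} (hab : a ≠ b)
    (h : MonoidAlgebra.single a 1 - MonoidAlgebra.single b 1
      ∈ Subalgebra.center R (MonoidAlgebra R Γ)) : a ∈ Subgroup.center Γ := by
  classical
  refine Subgroup.mem_center_iff.2 fun t => ?_
  by_contra hta
  have comm := congrArg (fun x => x.coeff (t * a))
    (Subalgebra.mem_center_iff.1 h (MonoidAlgebra.single t 1))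
  have two_ne_zero : (2 : R) ≠ 0 := NeZero.ne 2
  simp only [mul_sub, sub_mul, MonoidAlgebra.single_mul_single, one_mul, MonoidAlgebra.coeff_sub,
    Finsupp.sub_apply, MonoidAlgebra.coeff_single, Finsupp.single_apply, mul_right_inj, hab.symm,
    Ne.symm hta, if_true, if_false] at comm
  split_ifs at comm
  · exact two_ne_zero (by linear_combination comm)
  · exact two_ne_zero (by linear_combination 2 * comm)

lemma single_sub_single_notMem_center {a b : Γ} (hab : a ≠ b)
    (h : a ∉ Subgroup.center Γ ∨ b ∉ Subgroup.center Γ) :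
    MonoidAlgebra.single a 1 - MonoidAlgebra.single b 1
      ∉ Subalgebra.center R (MonoidAlgebra R Γ) := by
  intro hmem
  refine h.elim (· (mem_center_of_single_sub_single_mem_center hab hmem))
    (· (mem_center_of_single_sub_single_mem_center (R := R) hab.symm ?_))
  simpa using neg_mem hmem

end Center

namespace GroupDual

section Tensor

variable {Γ : Type u} {K : Type w} [AddCommGroup K] [Module ℂ K]

/-- The identification of `ℂ[Γ] ⊗ K` with the finitely supported families in `K` that sends
`∑ λ_g ⊗ k_g` to `(k_g)_g`. -/
noncomputable def tensorCoeff : MonoidAlgebra ℂ Γ ⊗[ℂ] K ≃ₗ[ℂ] (Γ →₀ K) :=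
  TensorProduct.congr (MonoidAlgebra.coeffLinearEquiv ℂ) (.refl ℂ K) ≪≫ₗ
    open Classical in TensorProduct.finsuppScalarLeft ℂ K Γ

lemma tensorCoeff_tmul_apply (x : MonoidAlgebra ℂ Γ) (k : K) (g : Γ) :
    tensorCoeff (x ⊗ₜ k) g = x.coeff g • k := by
  simp [tensorCoeff]

lemma tensorCoeff_single_tmul (g : Γ) (k : K) :
    tensorCoeff (MonoidAlgebra.single g 1 ⊗ₜ k) = Finsupp.single g k := by
  classical
  ext h
  rw [tensorCoeff_tmul_apply]
  simp [Finsupp.single_apply, ite_smul]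

lemma single_tmul_injective (g : Γ) :
    Function.Injective fun k : K => MonoidAlgebra.single g (1 : ℂ) ⊗ₜ[ℂ] k := fun k l h =>
  Finsupp.single_injective g (by simpa [tensorCoeff_single_tmul] using congrArg tensorCoeff h)

end Tensor

variable {Γ : Type u} [Group Γ]

lemma comulAction_hom_single (g : Γ) :
    (comulAction (MonoidAlgebra ℂ Γ)).hom (MonoidAlgebra.single g 1)
      = MonoidAlgebra.single g 1 ⊗ₜ MonoidAlgebra.single g 1 :=
  (MonoidAlgebra.isGroupLikeElem_single_one g).comul_eq_tmul_self

lemma isFaithful_comulAction : (comulAction (MonoidAlgebra ℂ Γ)).IsFaithful := by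
  refine eq_top_iff.2 ?_
  rintro x -
  induction x using MonoidAlgebra.induction_linear with
  | zero => exact zero_mem _
  | add x y hx hy => exact add_mem hx hy
  | single g c =>
    have smul_single : c • MonoidAlgebra.single g (1 : ℂ) = MonoidAlgebra.single g c := by
      simp [MonoidAlgebra.smul_single]
    rw [← smul_single]
    refine SMulMemClass.smul_mem c (StarAlgebra.subset_adjoin ℂ _
      ⟨Finsupp.lapply g ∘ₗ (MonoidAlgebra.coeffLinearEquiv ℂ).toLinearMap,
        MonoidAlgebra.single g 1, ?_⟩)
    rw [QuantumAction.slice, comulAction_hom_single]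
    simp

section Diagonal

variable {K : Type w} [Ring K] [StarRing K] [HopfAlgebra ℂ K] [StarModule ℂ K]

/-- The actions on `Γ̂` under which every line `ℂ λ_g` is invariant. -/
def IsDiagonal (β : QuantumAction (MonoidAlgebra ℂ Γ) K) : Prop :=
  ∀ g, ∃ u, β.hom (MonoidAlgebra.single g 1) = MonoidAlgebra.single g 1 ⊗ₜ u

variable {β : QuantumAction (MonoidAlgebra ℂ Γ) K}

lemma hom_single_mul {g h : Γ} {u v : K}
    (hg : β.hom (MonoidAlgebra.single g 1) = MonoidAlgebra.single g 1 ⊗ₜ u)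
    (hh : β.hom (MonoidAlgebra.single h 1) = MonoidAlgebra.single h 1 ⊗ₜ v) :
    β.hom (MonoidAlgebra.single (g * h) 1) = MonoidAlgebra.single (g * h) 1 ⊗ₜ (u * v) := by
  rw [← one_mul (1 : ℂ), ← MonoidAlgebra.single_mul_single, map_mul, hg, hh,
    Algebra.TensorProduct.tmul_mul_tmul]

lemma hom_single_inv {g : Γ} {u : K}
    (hg : β.hom (MonoidAlgebra.single g 1) = MonoidAlgebra.single g 1 ⊗ₜ u) :
    β.hom (MonoidAlgebra.single g⁻¹ 1) = MonoidAlgebra.single g⁻¹ 1 ⊗ₜ star u := by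
  simpa [TensorProduct.star_tmul, hg] using map_star β.hom (MonoidAlgebra.single g 1)

lemma isGroupLikeElem_of_hom_single_eq {g : Γ} {u : K}
    (hg : β.hom (MonoidAlgebra.single g 1) = MonoidAlgebra.single g 1 ⊗ₜ u) :
    IsGroupLikeElem ℂ u := by
  refine isGroupLikeElem_of_comul_eq_tmul_self ?_ (single_tmul_injective g ?_)
  · rintro rfl
    have h := β.injective (hg.trans ((TensorProduct.tmul_zero _ _).trans (map_zero β.hom).symm))
    simp at h
  · have coaction := β.action_eq (MonoidAlgebra.single g 1)
    rw [hg, TensorProduct.map_tmul, TensorProduct.map_tmul] at coaction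
    refine coaction.symm.trans ?_
    change TensorProduct.assoc ℂ _ K K (β.hom (MonoidAlgebra.single g 1) ⊗ₜ u) = _
    rw [hg]
    rfl

lemma exists_monoidHom_groupLike (hβ : IsDiagonal β) : ∃ f : Γ →* GroupLike ℂ K,
    ∀ g, β.hom (MonoidAlgebra.single g 1) = MonoidAlgebra.single g 1 ⊗ₜ (f g : K) := by
  choose u hu using hβ
  refine ⟨⟨⟨fun g => ⟨u g, isGroupLikeElem_of_hom_single_eq (hu g)⟩, ?_⟩, fun g h => ?_⟩, hu⟩
  · refine GroupLike.val_injective (single_tmul_injective (1 : Γ) ((hu 1).symm.trans ?_))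
    rw [← MonoidAlgebra.one_def, map_one]
    rfl
  · exact GroupLike.val_injective
      (single_tmul_injective (g * h) ((hu _).symm.trans (hom_single_mul (hu g) (hu h))))

lemma map_comulAction_hom_eq_iff {f : Γ → K}
    (hf : ∀ g, β.hom (MonoidAlgebra.single g 1) = MonoidAlgebra.single g 1 ⊗ₜ f g)
    (γ : MonoidAlgebra ℂ Γ →ₐc[ℂ] K) :
    (∀ x, TensorProduct.map LinearMap.id (γ : MonoidAlgebra ℂ Γ →ₐ[ℂ] K).toLinearMap
        ((comulAction (MonoidAlgebra ℂ Γ)).hom x) = β.hom x) ↔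
      ∀ g, γ (MonoidAlgebra.single g 1) = f g := by
  refine ⟨fun h g => single_tmul_injective g ?_, fun h => LinearMap.congr_fun
    (f := TensorProduct.map LinearMap.id (γ : MonoidAlgebra ℂ Γ →ₐ[ℂ] K).toLinearMap ∘ₗ
      (comulAction (MonoidAlgebra ℂ Γ)).hom.toAlgHom.toLinearMap)
    (g := β.hom.toAlgHom.toLinearMap)
    (MonoidAlgebra.lhom_ext' fun g => LinearMap.ext_ring ?_)⟩
  · simpa [comulAction_hom_single, hf] using h (MonoidAlgebra.single g 1)
  · simp [comulAction_hom_single, hf, h]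

lemma existsUnique_bialgHom_of_isDiagonal (hβ : IsDiagonal β) :
    ∃! γ : MonoidAlgebra ℂ Γ →ₐc[ℂ] K, (∀ x, γ (star x) = star (γ x)) ∧
      ∀ x : MonoidAlgebra ℂ Γ,
        TensorProduct.map (LinearMap.id : MonoidAlgebra ℂ Γ →ₗ[ℂ] MonoidAlgebra ℂ Γ)
          (γ : MonoidAlgebra ℂ Γ →ₐ[ℂ] K).toLinearMap
          ((comulAction (MonoidAlgebra ℂ Γ)).hom x) = β.hom x := by
  obtain ⟨f, hf⟩ := exists_monoidHom_groupLike hβ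
  let γ := (MonoidAlgebra.liftGroupLikeBialgHom (R := ℂ) (A := K)).comp
    (MonoidAlgebra.mapDomainBialgHom ℂ f)
  have hγ (g : Γ) (c : ℂ) : γ (MonoidAlgebra.single g c) = c • (f g : K) := by simp [γ]
  refine ⟨γ, ⟨fun x => ?_, (map_comulAction_hom_eq_iff hf γ).2 fun g => by rw [hγ, one_smul]⟩,
    fun γ' hγ' => BialgHom.coe_linearMap_injective (MonoidAlgebra.lhom_ext' fun g =>
      LinearMap.ext_ring ?_)⟩
  · induction x using MonoidAlgebra.induction_linear with
    | zero => simp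
    | add x y hx hy => simp only [star_add, map_add, hx, hy]
    | single g c =>
      have hstar : (f g⁻¹ : K) = star (f g : K) :=
        single_tmul_injective g⁻¹ ((hf g⁻¹).symm.trans (hom_single_inv (hf g)))
      rw [star_single, hγ, hγ, star_smul, hstar]
  · simpa [hγ] using (map_comulAction_hom_eq_iff hf γ').1 hγ'.2 g

lemma isDiagonal_of_forall_notMem {Z : Subgroup Γ} (hZ : Z ≠ ⊤)
    (h : ∀ g ∉ Z, ∃ u, β.hom (MonoidAlgebra.single g 1) = MonoidAlgebra.single g 1 ⊗ₜ u) :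
    IsDiagonal β := by
  intro g
  by_cases hg : g ∈ Z
  · obtain ⟨a, ha⟩ := SetLike.exists_not_mem_of_ne_top Z hZ rfl
    obtain ⟨u, hu⟩ := h (g * a) (mt (Subgroup.mul_mem_cancel_left _ hg).1 ha)
    obtain ⟨v, hv⟩ := h a⁻¹ (mt inv_mem_iff.1 ha)
    exact ⟨u * v, by simpa using hom_single_mul hu hv⟩
  · exact h g hg

end Diagonal

section CayleyGraph

variable [Fintype Γ]

lemma psi_antipode_mul_single (P : MonoidAlgebra ℂ Γ) (g : Γ) :
    FiniteQuantumSet.psi (HopfAlgebra.antipode ℂ P * MonoidAlgebra.single g (1 : ℂ))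
      = Fintype.card Γ * P.coeff g := by
  classical
  refine (haar_apply _).trans (congrArg _ ?_)
  induction P using MonoidAlgebra.induction_linear with
  | zero => simp
  | add x y hx hy => simp [add_mul, hx, hy]
  | single h d => simp [MonoidAlgebra.single_mul_single, Finsupp.single_apply, inv_mul_eq_one]

lemma cayleyAdjacency_single (P : MonoidAlgebra ℂ Γ) (g : Γ) :
    cayleyAdjacency P (MonoidAlgebra.single g 1)
      = (Fintype.card Γ * P.coeff g) • MonoidAlgebra.single g 1 := by
  rw [← psi_antipode_mul_single]
  simp [cayleyAdjacency, convLeft, psiAt]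

lemma coeff_cayleyAdjacency (P x : MonoidAlgebra ℂ Γ) (g : Γ) :
    (cayleyAdjacency P x).coeff g = Fintype.card Γ * P.coeff g * x.coeff g := by
  classical
  induction x using MonoidAlgebra.induction_linear with
  | zero => simp
  | add x y hx hy => simp [hx, hy, mul_add]
  | single h c =>
    rw [← mul_one c, ← smul_eq_mul, ← MonoidAlgebra.smul_single, map_smul, cayleyAdjacency_single]
    rcases eq_or_ne h g with rfl | hg <;> simp_all [mul_comm]

lemma schurProduct_cayleyAdjacency (P Q : MonoidAlgebra ℂ Γ) :
    schurProduct (cayleyAdjacency P) (cayleyAdjacency Q) = cayleyAdjacency (P * Q) := by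
  refine MonoidAlgebra.lhom_ext' fun g => LinearMap.ext_ring ?_
  have coeff_mul : (P * Q).coeff g = ∑ h, P.coeff h * Q.coeff (h⁻¹ * g) := by
    rw [MonoidAlgebra.coeff_mul_apply_left, Finsupp.sum_fintype _ _ (by simp)]
  have card_ne_zero : (Fintype.card Γ : ℂ) ≠ 0 := by simp
  change LinearMap.mul' ℂ _ (TensorProduct.map _ _ (mulAdjoint Γ (MonoidAlgebra.single g 1)))
    = cayleyAdjacency _ (MonoidAlgebra.single g 1)
  rw [mulAdjoint_single, cayleyAdjacency_single, coeff_mul]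
  simp only [map_smul, map_sum, TensorProduct.map_tmul, cayleyAdjacency_single,
    LinearMap.mul'_apply, smul_mul_assoc, mul_smul_comm, MonoidAlgebra.single_mul_single,
    mul_inv_cancel_left, one_mul, smul_smul, ← Finset.sum_smul, Finset.mul_sum]
  congr 1
  exact Finset.sum_congr rfl fun h _ => by field_simp

lemma star_cayleyAdjacency_star (P f : MonoidAlgebra ℂ Γ) :
    star (cayleyAdjacency P (star f)) = cayleyAdjacency (star P) f := by
  apply MonoidAlgebra.coeff_injective
  ext g
  simp [coeff_star, coeff_cayleyAdjacency]

lemma isQuantumGraph_cayleyAdjacency {P : MonoidAlgebra ℂ Γ} (hP : IsStarProjection P) :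
    IsQuantumGraph (cayleyAdjacency P) where
  schur_idempotent := by rw [schurProduct_cayleyAdjacency, hP.isIdempotentElem.eq]
  real f := by rw [star_cayleyAdjacency_star, hP.isSelfAdjoint.star_eq]

lemma isGraphAction_comulAction (P : MonoidAlgebra ℂ Γ) :
    (comulAction (MonoidAlgebra ℂ Γ)).IsGraphAction (cayleyAdjacency P) where
  preserves_psi x := by
    refine LinearMap.congr_fun
      (f := (TensorProduct.lid ℂ _).toLinearMap ∘ₗ TensorProduct.map FiniteQuantumSet.psi .id ∘ₗ
        (comulAction (MonoidAlgebra ℂ Γ)).hom.toAlgHom.toLinearMap)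
      (g := Algebra.linearMap ℂ _ ∘ₗ FiniteQuantumSet.psi)
      (MonoidAlgebra.lhom_ext' fun g => LinearMap.ext_ring ?_) x
    rcases eq_or_ne g 1 with rfl | hg
    · simp [comulAction_hom_single, Algebra.algebraMap_eq_smul_one, MonoidAlgebra.one_def]
    · have : FiniteQuantumSet.psi (MonoidAlgebra.single g (1 : ℂ)) = 0 :=
        (haar_apply _).trans (by simp [hg])
      simp [comulAction_hom_single, this]
  preserves_adjacency x := by
    refine LinearMap.congr_fun
      (f := TensorProduct.map (cayleyAdjacency P) .id ∘ₗ
        (comulAction (MonoidAlgebra ℂ Γ)).hom.toAlgHom.toLinearMap)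
      (g := (comulAction (MonoidAlgebra ℂ Γ)).hom.toAlgHom.toLinearMap ∘ₗ cayleyAdjacency P)
      (MonoidAlgebra.lhom_ext' fun g => LinearMap.ext_ring ?_) x
    simp [comulAction_hom_single, cayleyAdjacency_single, TensorProduct.smul_tmul',
      -MonoidAlgebra.smul_single]

lemma tensorCoeff_map_cayleyAdjacency {K : Type w} [AddCommGroup K] [Module ℂ K]
    (P : MonoidAlgebra ℂ Γ) (x : MonoidAlgebra ℂ Γ ⊗[ℂ] K) (g : Γ) :
    tensorCoeff (TensorProduct.map (cayleyAdjacency P) LinearMap.id x) g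
      = (Fintype.card Γ * P.coeff g) • tensorCoeff x g := by
  induction x using TensorProduct.induction_on with
  | zero => simp
  | add x y hx hy => simp only [map_add, Finsupp.add_apply, hx, hy, smul_add]
  | tmul a k => simp [tensorCoeff_tmul_apply, coeff_cayleyAdjacency, smul_smul]

section GraphAction

variable {K : Type w} [Ring K] [StarRing K] [HopfAlgebra ℂ K] [StarModule ℂ K]
  {β : QuantumAction (MonoidAlgebra ℂ Γ) K} {P : MonoidAlgebra ℂ Γ}

lemma tensorCoeff_hom_single_eq_zero (hβ : β.IsGraphAction (cayleyAdjacency P)) {g h : Γ}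
    (hgh : P.coeff h ≠ P.coeff g) : tensorCoeff (β.hom (MonoidAlgebra.single g 1)) h = 0 := by
  have eigen := congrArg (tensorCoeff · h) (hβ.preserves_adjacency (MonoidAlgebra.single g 1))
  simp only [tensorCoeff_map_cayleyAdjacency, cayleyAdjacency_single, map_smul,
    Finsupp.smul_apply] at eigen
  rw [← sub_eq_zero, ← sub_smul, ← mul_sub, smul_eq_zero] at eigen
  exact eigen.resolve_left (mul_ne_zero (by simp) (sub_ne_zero.2 hgh))

lemma exists_hom_single_eq_single_tmul (hβ : β.IsGraphAction (cayleyAdjacency P)) {g : Γ}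
    (hg : ∀ h, h ≠ g → P.coeff h ≠ P.coeff g) :
    ∃ u, β.hom (MonoidAlgebra.single g 1) = MonoidAlgebra.single g 1 ⊗ₜ u := by
  refine ⟨tensorCoeff (β.hom (MonoidAlgebra.single g 1)) g, tensorCoeff.injective ?_⟩
  rw [tensorCoeff_single_tmul]
  ext h
  rcases eq_or_ne h g with rfl | hh
  · simp
  · rw [tensorCoeff_hom_single_eq_zero hβ (hg h hh), Finsupp.single_eq_of_ne hh]

end GraphAction

lemma isQuantumAutomorphismGroup_comulAction {P : MonoidAlgebra ℂ Γ} {Z : Subgroup Γ} (hZ : Z ≠ ⊤)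
    (hP : ∀ g ∉ Z, ∀ h, h ≠ g → P.coeff h ≠ P.coeff g) :
    IsQuantumAutomorphismGroup.{u, u, v} (cayleyAdjacency P)
      (comulAction (MonoidAlgebra ℂ Γ)) where
  isGraphAction := isGraphAction_comulAction P
  isFaithful := isFaithful_comulAction
  universal _ _ _ _ _ _ _ hβ := existsUnique_bialgHom_of_isDiagonal <|
    isDiagonal_of_forall_notMem hZ fun g hg => exists_hom_single_eq_single_tmul hβ (hP g hg)

lemma exists_isStarProjection_coeff_ne (Γ : Type u) [Group Γ] [Finite Γ] :
    ∃ P : MonoidAlgebra ℂ Γ, IsStarProjection P ∧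
      (∀ {V : Type w} [AddCommGroup V] [Module ℂ V] (ρ : Representation ℂ Γ V) [ρ.IsIrreducible],
        Module.finrank ℂ (LinearMap.range (ρ.asAlgebraHom P))
          = if 1 < Module.finrank ℂ V then 1 else 0) ∧
      ∀ g h : Γ, g ≠ h → (g ∉ Subgroup.center Γ ∨ h ∉ Subgroup.center Γ) →
        P.coeff g ≠ P.coeff h := by
  have := Fintype.ofFinite Γ
  obtain ⟨m, d, hd, ⟨φ⟩⟩ := FiniteQuantumSet.exists_starAlgEquiv_pi_matrix (MonoidAlgebra ℂ Γ)
  let J := {p : Γ × Γ // p.1 ≠ p.2 ∧ (p.1 ∉ Subgroup.center Γ ∨ p.2 ∉ Subgroup.center Γ)}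
  obtain ⟨P, hP, hrank, hpsi⟩ := FiniteQuantumSet.exists_isStarProjection_psi_mul_ne_zero φ
    (a := fun j : J => MonoidAlgebra.single j.1.1⁻¹ 1 - MonoidAlgebra.single j.1.2⁻¹ 1)
    fun j => single_sub_single_notMem_center (inv_injective.ne j.2.1) (by simpa using j.2.2)
  refine ⟨P, hP, fun ρ _ => ?_, fun g h hgh hc heq => hpsi ⟨(g, h), hgh, hc⟩ ?_⟩
  · obtain ⟨i, hi, hrange⟩ := exists_finrank_range_asAlgebraHom_eq_rank φ.toAlgEquiv ρ
    rw [hrange, hi]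
    exact hrank i
  · refine (haar_apply _).trans ?_
    simp [mul_sub, heq]

end CayleyGraph

end GroupDual

theorem theoremB (Γ : Type u) [Group Γ] [Fintype Γ] (hΓ : ∃ a b : Γ, a * b ≠ b * a) :
    ∃ P : MonoidAlgebra ℂ Γ,
      -- `P` is an orthogonal projection in `C(Γ̂) = ℂ[Γ]`
      IsStarProjection P ∧
      -- `(Γ̂, A_P)` with `A_P = P ⋆ ·` is a quantum graph
      IsQuantumGraph (cayleyAdjacency P) ∧
      -- `Qut(Γ̂, A_P) = Γ̂`, acting on itself by its comultiplication
      IsQuantumAutomorphismGroup.{u, u, v} (cayleyAdjacency P)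
        (comulAction (MonoidAlgebra ℂ Γ)) ∧
      -- `P` has rank one in each block of dimension `> 1` and vanishes in the other blocks
      (∀ (n : ℕ) (ρ : Representation ℂ Γ (Fin n → ℂ)), ρ.IsIrreducible →
        Module.finrank ℂ (LinearMap.range (ρ.asAlgebraHom P)) = if 1 < n then 1 else 0) ∧
      -- the Fourier transform of `P` separates two elements one of which is not central
      (∀ g h : Γ, g ≠ h → (g ∉ Subgroup.center Γ ∨ h ∉ Subgroup.center Γ) →
        P.coeff g ≠ P.coeff h) := by
  obtain ⟨P, hP, hrank, hcoeff⟩ := GroupDual.exists_isStarProjection_coeff_ne Γ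
  have center_ne_top : Subgroup.center Γ ≠ ⊤ := by
    obtain ⟨a, b, hab⟩ := hΓ
    intro h
    exact hab (Subgroup.mem_center_iff.1 (h ▸ Subgroup.mem_top b) a)
  refine ⟨P, hP, GroupDual.isQuantumGraph_cayleyAdjacency hP,
    GroupDual.isQuantumAutomorphismGroup_comulAction center_ne_top fun g hg h hgh =>
      hcoeff h g hgh (.inr hg), fun n ρ hρ => ?_, hcoeff⟩
  simpa using hrank ρ
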